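/- All graphs are simple, undirected and locally finite. The product $X\times Y$ of two graphs has vertex set $V_X\times V_Y$, with $(x_1,y_1)$ and $(x_2,y_2)$ adjacent iff either $x_1=x_2$ and $y_1y_2\in E_Y$, or $y_1=y_2$ and $x_1x_2\in E_X$. A graph $X$ is nonamenable if there is $c>0$ such that $|\partial K|\ge c|K|$ for every finite set $K\subset V_X$, where $\partial K$ is the set of vertices outside $K$ that are adjacent to a vertex of $K$. The group ${\rm Aut}(X)$ carries the topology of pointwise convergence. A subgroup $G\subset{\rm Aut}(X)$ is quasi-transitive if it has finitely many orbits on $V_X$, and a closed subgroup $G$ is unimodular if it has a left Haar measure that is also right-invariant. Given i.i.d. labels $(U_e)_{e\in E}$, uniform on $[0,1]$, on the edges of a graph, the free minimal spanning forest is the random spanning subgraph that retains an edge $e$ iff there is no path between the endpoints of $e$ all of whose edges have labels lower than $U_e$. **Corollary.** Let $X$ be a connected nonamenable graph, and suppose that some closed subgroup $G\subset {\rm Aut}(X)$ is quasi-transitive and unimodular. Let $Y$ be a graph, and suppose that some subgroup $H\subset{\rm Aut}(Y)$ has an infinite orbit on $V_Y$. Then the free minimal spanning forest on $X\times Y$ almost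 surely has infinitely many connected components. -/

import Mathlib

open MeasureTheory

namespace SimpleGraph

variable {V : Type*}

/-- The (outer) vertex boundary of a finite set `K` of vertices: the vertices outside `K` that are
adjacent to some vertex of `K`. -/
def outerBoundary (X : SimpleGraph V) (K : Finset V) : Set V :=
  {v | v ∉ K ∧ ∃ u ∈ K, X.Adj u v}

/-- A locally finite graph is nonamenable if its isoperimetric (Cheeger) constant
`inf {|∂K| / |K| : K finite nonempty set of vertices}` is positive. -/
def IsNonamenable (X : SimpleGraph V) : Prop :=
  ∃ c : ℝ, 0 < c ∧ ∀ K : Finset V, c * (K.card : ℝ) ≤ ((X.outerBoundary K).ncard : ℝ)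

/-- The topology of pointwise convergence on the automorphism group of a graph
(the vertex set being discrete). -/
instance autTopologicalSpace (X : SimpleGraph V) : TopologicalSpace (X ≃g X) :=
  TopologicalSpace.induced (fun g : X ≃g X => (g : V → V))
    (@Pi.topologicalSpace V (fun _ => V) (fun _ => ⊥))

/-- A group of automorphisms is quasi-transitive if it has finitely many orbits of vertices. -/
def IsQuasiTransitive {X : SimpleGraph V} (G : Subgroup (X ≃g X)) : Prop :=
  Finite (MulAction.orbitRel.Quotient G V)

/-- The free minimal spanning forest of `X` for the edge labels `U`: the spanning subgraph of `X`
that retains an edge `e` iff there is no path in `X` between the endpoints of `e` all of whose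
edges have labels lower than `U e`. -/
def freeMinimalSpanningForest (X : SimpleGraph V) (U : X.edgeSet → ℝ) : SimpleGraph V where
  Adj u v := ∃ h : s(u, v) ∈ X.edgeSet,
    ¬ ∃ p : X.Walk u v, p.IsPath ∧
      ∀ (e : Sym2 V) (he : e ∈ p.edges), U ⟨e, p.edges_subset_edgeSet he⟩ < U ⟨s(u, v), h⟩
  symm := ⟨by
    rintro u v ⟨h, hp⟩
    have hs : s(v, u) = s(u, v) := Sym2.eq_swap
    refine ⟨hs ▸ h, ?_⟩
    rintro ⟨p, hpath, hlt⟩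
    refine hp ⟨p.reverse, hpath.reverse, fun e he => ?_⟩
    have he' : e ∈ p.edges := by simpa using he
    simpa only [hs] using hlt e he'⟩
  loopless := ⟨fun u ⟨h, _⟩ => X.loopless.irrefl u h⟩

end SimpleGraph

/-- A (locally compact) topological group is unimodular if it carries a left Haar measure, on its
Borel σ-algebra, that is also invariant under right translations. -/
def IsUnimodularGroup (G : Type*) [Group G] [TopologicalSpace G] : Prop :=
  letI : MeasurableSpace G := borel G
  ∃ μ : Measure G, μ.IsHaarMeasure ∧ μ.Regular ∧ μ.IsMulRightInvariant

/-! Of the minimal spanning forest only two properties matter: it is acyclic and its law is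
invariant under `G` and `H`. Suppose such a forest `T` has at most `k` components on an event `E` of
positive probability. Take `k + 1` heights in an infinite `H`-orbit, with disjoint `R`-balls `B i`
around them. Two vertices of `X` lie in one cell if, at every height `y i`, their lifts are joined
inside the slab `V × B i`.

Cells are finite a.s. on `E` (`ae_finite_cells`). By pigeonhole, for each `x` two of the lifts `(x,
y i)`, `(x, y j)` share a component of `T`. As `T` is a forest, there is a unique last vertex at
which one leaves the slab component of `(x, y i)` towards `(x, y j)`, and it is the same for the
whole cell. If every `x` in an infinite cell sends mass 1 to the projection of this exit, some
vertex receives infinite mass while each sends at most 1. The mass transport principle, which is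
where unimodularity enters, forbids this.

By nonamenability some `r` makes the `r`-neighbourhood of each finite set at least `n` times larger
than the set. A second transport (`growth_le_of_cells`) then shows that a vertex sees on average at
least `n` cells within distance `r` on `E`. For large `R`, connections at height `y i` between
vertices of a fixed ball are, with high probability, already made inside the slab. The ball then
meets at most `k ^ (k + 1)` cells, one per vector of component labels. Taking `n = k ^ (k + 1) + 2`
gives a contradiction. -/

namespace SimpleGraph

/-! ### Balls, growth and countability -/

variable {V W : Type*}

/-- The vertices at distance at most `n` from `v`. -/
def closedBall (X : SimpleGraph V) (v : V) (n : ℕ) : Set V :=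
  {u | ∃ p : X.Walk v u, p.length ≤ n}

lemma mem_closedBall_self (X : SimpleGraph V) (v : V) (n : ℕ) : v ∈ X.closedBall v n :=
  ⟨Walk.nil, by simp⟩

lemma mem_closedBall_comm {X : SimpleGraph V} {u v : V} {n : ℕ} :
    u ∈ X.closedBall v n ↔ v ∈ X.closedBall u n :=
  ⟨fun ⟨p, hp⟩ => ⟨p.reverse, by simpa⟩, fun ⟨p, hp⟩ => ⟨p.reverse, by simpa⟩⟩

lemma mem_closedBall_add {X : SimpleGraph V} {u v w : V} {m n : ℕ}
    (h₁ : v ∈ X.closedBall u m) (h₂ : w ∈ X.closedBall v n) : w ∈ X.closedBall u (m + n) := by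
  obtain ⟨p, hp⟩ := h₁
  obtain ⟨q, hq⟩ := h₂
  exact ⟨p.append q, by rw [Walk.length_append]; omega⟩

lemma closedBall_mono (X : SimpleGraph V) (v : V) {m n : ℕ} (h : m ≤ n) :
    X.closedBall v m ⊆ X.closedBall v n :=
  fun _ ⟨p, hp⟩ => ⟨p, hp.trans h⟩

lemma finite_closedBall {X : SimpleGraph V} (hX : ∀ v, (X.neighborSet v).Finite) (v : V) (n : ℕ) :
    (X.closedBall v n).Finite := by
  induction n with
  | zero =>
    refine (Set.finite_singleton v).subset ?_
    rintro u ⟨p, hp⟩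
    exact (Walk.eq_of_length_eq_zero (Nat.le_zero.1 hp)).symm
  | succ n ih =>
    refine (ih.union (ih.biUnion fun u _ => hX u)).subset ?_
    intro u hu
    obtain ⟨p, hp⟩ := mem_closedBall_comm.1 hu
    cases p with
    | nil => exact Or.inl (X.mem_closedBall_self _ n)
    | @cons _ w _ h q =>
      refine Or.inr (Set.mem_iUnion₂.2 ⟨w, mem_closedBall_comm.1 ⟨q, ?_⟩, h.symm⟩)
      simpa using hp

lemma map_mem_closedBall {X : SimpleGraph V} {Y : SimpleGraph W} (φ : X ≃g Y) {u v : V} {n : ℕ} :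
    φ u ∈ Y.closedBall (φ v) n ↔ u ∈ X.closedBall v n := by
  constructor
  · rintro ⟨p, hp⟩
    refine ⟨(p.map φ.symm.toHom).copy (by simp) (by simp), by simpa using hp⟩
  · rintro ⟨p, hp⟩
    exact ⟨p.map φ.toHom, by simpa using hp⟩

/-- Finite balls around one representative per component exhaust the graph. Countability underlies
all later measurability and almost-sure arguments. -/
lemma countable_of_finite_connectedComponent {X : SimpleGraph V} [Finite X.ConnectedComponent]
    (hX : ∀ v, (X.neighborSet v).Finite) : Countable V := by
  have key : (Set.univ : Set V) ⊆
      ⋃ C : X.ConnectedComponent, ⋃ n : ℕ, X.closedBall C.out n := by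
    intro v _
    have h : X.Reachable (X.connectedComponentMk v).out v :=
      ConnectedComponent.exact (Quot.out_eq _)
    obtain ⟨p⟩ := h
    exact Set.mem_iUnion₂.2 ⟨_, p.length, p, le_rfl⟩
  have : (Set.univ : Set V).Countable :=
    (Set.countable_iUnion fun C => Set.countable_iUnion fun n =>
      (finite_closedBall hX _ n).countable).mono key
  exact Set.countable_univ_iff.1 this

/-- In a nonamenable graph, neighbourhoods of finite sets grow exponentially. -/
lemma pow_mul_ncard_le {X : SimpleGraph V} (hX : ∀ v, (X.neighborSet v).Finite) {c : ℝ}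
    (hc : 0 ≤ c) (hna : ∀ K : Finset V, c * (K.card : ℝ) ≤ ((X.outerBoundary K).ncard : ℝ))
    {K : Set V} (hK : K.Finite) (r : ℕ) :
    (1 + c) ^ r * (K.ncard : ℝ) ≤ ((⋃ z ∈ K, X.closedBall z r).ncard : ℝ) := by
  have hfin (r : ℕ) : (⋃ z ∈ K, X.closedBall z r).Finite :=
    hK.biUnion fun z _ => finite_closedBall hX z r
  induction r with
  | zero =>
    have : K ⊆ ⋃ z ∈ K, X.closedBall z 0 :=
      fun z hz => Set.mem_iUnion₂.2 ⟨z, hz, X.mem_closedBall_self z 0⟩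
    simpa using Set.ncard_le_ncard this (hfin 0)
  | succ r ih =>
    set N : Set V := ⋃ z ∈ K, X.closedBall z r
    have hb := hna (hfin r).toFinset
    rw [← Set.ncard_eq_toFinset_card N (hfin r)] at hb
    have hsub : N ∪ X.outerBoundary (hfin r).toFinset ⊆ ⋃ z ∈ K, X.closedBall z (r + 1) := by
      rintro v (hv | ⟨-, u, hu, huv⟩)
      · obtain ⟨z, hz, hzv⟩ := Set.mem_iUnion₂.1 hv
        exact Set.mem_iUnion₂.2 ⟨z, hz, X.closedBall_mono z r.le_succ hzv⟩
      · obtain ⟨z, hz, hzu⟩ := Set.mem_iUnion₂.1 ((Set.Finite.mem_toFinset _).1 hu)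
        exact Set.mem_iUnion₂.2 ⟨z, hz, mem_closedBall_add hzu ⟨huv.toWalk, by simp⟩⟩
    have hdis : Disjoint N (X.outerBoundary (hfin r).toFinset) :=
      Set.disjoint_left.2 fun v hv hv' => hv'.1 ((hfin r).mem_toFinset.2 hv)
    have hle := Set.ncard_le_ncard hsub (hfin (r + 1))
    rw [Set.ncard_union_eq hdis (hfin r)
      ((hfin (r + 1)).subset (Set.subset_union_right.trans hsub))] at hle
    have hle' : (N.ncard : ℝ) + ((X.outerBoundary (hfin r).toFinset).ncard : ℝ) ≤
        ((⋃ z ∈ K, X.closedBall z (r + 1)).ncard : ℝ) := by exact_mod_cast hle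
    calc (1 + c) ^ (r + 1) * (K.ncard : ℝ) = (1 + c) * ((1 + c) ^ r * K.ncard) := by ring
      _ ≤ (1 + c) * N.ncard := by gcongr
      _ ≤ _ := by linarith

/-! ### Exits in forests, reachability and products -/

/-- The graph `T` with all edges not contained in the vertex set `A` removed. -/
def within (T : SimpleGraph V) (A : Set V) : SimpleGraph V where
  Adj u v := T.Adj u v ∧ u ∈ A ∧ v ∈ A
  symm := ⟨fun _ _ h => ⟨h.1.symm, h.2.2, h.2.1⟩⟩
  loopless := ⟨fun u h => T.loopless.irrefl u h.1⟩

lemma within_mono (T : SimpleGraph V) {A B : Set V} (h : A ⊆ B) : T.within A ≤ T.within B :=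
  fun _ _ huv => ⟨huv.1, h huv.2.1, h huv.2.2⟩

lemma Reachable.mem_of_within {T : SimpleGraph V} {A : Set V} {u v : V}
    (h : (T.within A).Reachable u v) (hu : u ∈ A) : v ∈ A := by
  obtain ⟨p⟩ := h
  induction p with
  | nil => exact hu
  | cons h _ ih => exact ih h.2.2

lemma reachable_comap_equiv {T : SimpleGraph W} (γ : V ≃ W) {u v : V} :
    (T.comap γ).Reachable u v ↔ T.Reachable (γ u) (γ v) :=
  (Iso.reachable_iff (φ := Iso.comap γ T)).symm

lemma adj_not_reachable_deleteEdges {T : SimpleGraph V} (hT : T.IsAcyclic) {a b : V}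
    (hab : T.Adj a b) : ¬ (T.deleteEdges {s(a, b)}).Reachable a b :=
  isBridge_iff.1 (isAcyclic_iff_forall_adj_isBridge.1 hT hab)

/-- In a forest, the vertex through which one leaves a connected set `A` in order to reach `t` is
unique. Here `A` is the set of vertices reachable from `s` inside `B`. -/
lemma exit_unique {T : SimpleGraph V} (hT : T.IsAcyclic) {B : Set V} {s t a a' b b' : V}
    (hs : s ∈ B)
    (ha : (T.within B).Reachable s a) (ha' : (T.within B).Reachable s a')
    (hab : T.Adj a b) (hab' : T.Adj a' b')
    (hb : ¬ (T.within B).Reachable s b)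
    (hbt : (T.within {v | ¬ (T.within B).Reachable s v}).Reachable b t)
    (hbt' : (T.within {v | ¬ (T.within B).Reachable s v}).Reachable b' t) : a = a' := by
  by_contra hne
  -- If `a ≠ a'`, the route `a → s → a' → b' → t → b` avoids the edge `ab`, which is a bridge: its
  -- first part stays inside the component of `s`, its last part outside, and `a'b'` is a different
  -- edge.
  have h₁ : T.within B ≤ T.deleteEdges {s(a, b)} := by
    intro u v huv
    refine (T.deleteEdges_adj).2 ⟨huv.1, fun h => hb ?_⟩
    have hbB : b ∈ B := by
      rcases Sym2.eq_iff.1 (Set.mem_singleton_iff.1 h) with ⟨-, rfl⟩ | ⟨rfl, -⟩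
      exacts [huv.2.2, huv.2.1]
    exact ha.trans (Adj.reachable ⟨hab, ha.mem_of_within hs, hbB⟩)
  have h₂ : T.within {v | ¬ (T.within B).Reachable s v} ≤ T.deleteEdges {s(a, b)} := by
    intro u v huv
    refine (T.deleteEdges_adj).2 ⟨huv.1, fun h => ?_⟩
    rcases Sym2.eq_iff.1 (Set.mem_singleton_iff.1 h) with ⟨rfl, -⟩ | ⟨-, rfl⟩
    exacts [huv.2.1 ha, huv.2.2 ha]
  have h₃ : (T.deleteEdges {s(a, b)}).Adj a' b' := by
    refine (T.deleteEdges_adj).2 ⟨hab', fun h => ?_⟩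
    rcases Sym2.eq_iff.1 (Set.mem_singleton_iff.1 h) with ⟨rfl, -⟩ | ⟨rfl, -⟩
    exacts [hne rfl, hb ha']
  exact adj_not_reachable_deleteEdges hT hab
    ((((ha.symm.trans ha').mono h₁).trans h₃.reachable).trans ((hbt'.trans hbt.symm).mono h₂))

/-- Cut a walk at its last departure from `A`. The induction therefore carries the alternative that
the walk avoids `A` altogether. -/
lemma exists_exit {T : SimpleGraph V} {A : Set V} {s t : V} (hs : s ∈ A) (ht : t ∉ A)
    (h : T.Reachable s t) :
    ∃ a b, a ∈ A ∧ b ∉ A ∧ T.Adj a b ∧ (T.within Aᶜ).Reachable b t := by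
  obtain ⟨p⟩ := h
  have key : ∀ {u v : V} (p : T.Walk u v), v ∉ A → (u ∉ A ∧ (T.within Aᶜ).Reachable u v) ∨
      ∃ a b, a ∈ A ∧ b ∉ A ∧ T.Adj a b ∧ (T.within Aᶜ).Reachable b v := by
    intro u v p hv
    induction p with
    | nil => exact Or.inl ⟨hv, Reachable.refl _⟩
    | @cons u u' v h q ih =>
      rcases ih hv with ⟨hu', hr⟩ | h'
      · by_cases hu : u ∈ A
        · exact Or.inr ⟨u, u', hu, hu', h, hr⟩
        · exact Or.inl ⟨hu, (Adj.reachable (⟨h, hu, hu'⟩ : (T.within Aᶜ).Adj u u')).trans hr⟩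
      · exact Or.inr h'
  exact (key p ht).resolve_left fun h => h.1 hs

lemma measurable_reachable [Countable V] {Λ : Type*} [MeasurableSpace Λ] {T : Λ → SimpleGraph V}
    (hT : ∀ u v, Measurable fun U => (T U).Adj u v) (u v : V) :
    Measurable fun U => (T U).Reachable u v := by
  have key : ∀ (n : ℕ) (u : V), Measurable fun U => ∃ p : (T U).Walk u v, p.length = n := by
    intro n
    induction n with
    | zero =>
      intro u
      have : (fun U => ∃ p : (T U).Walk u v, p.length = 0) = fun _ => u = v := by
        ext U; exact Walk.exists_length_eq_zero_iff
      rw [this]; exact measurable_const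
    | succ n ih =>
      intro u
      have : (fun U => ∃ p : (T U).Walk u v, p.length = n + 1) =
          fun U => ∃ w, (T U).Adj u w ∧ ∃ p : (T U).Walk w v, p.length = n := by
        ext U
        constructor
        · rintro ⟨p, hp⟩
          cases p with
          | nil => simp at hp
          | cons h q => exact ⟨_, h, q, by simpa using hp⟩
        · rintro ⟨w, h, q, hq⟩
          exact ⟨Walk.cons h q, by simpa using hq⟩
      rw [this]
      exact Measurable.exists fun w => (hT u w).and (ih w)
  have : (fun U => (T U).Reachable u v) = fun U => ∃ n, ∃ p : (T U).Walk u v, p.length = n := by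
    ext U
    exact ⟨fun ⟨p⟩ => ⟨_, p, rfl⟩, fun ⟨_, p, _⟩ => ⟨p⟩⟩
  rw [this]
  exact Measurable.exists fun n => key n u

/-- Projection to `Y` maps components onto components. This disposes of the case in which `W` need
not be countable. -/
lemma infinite_connectedComponent_of_boxProd [Nonempty V] {X : SimpleGraph V} {Y : SimpleGraph W}
    [Infinite Y.ConnectedComponent] {T : SimpleGraph (V × W)} (hT : T ≤ X □ Y) :
    Infinite T.ConnectedComponent := by
  have key : ∀ {p q : V × W}, T.Reachable p q → Y.Reachable p.2 q.2 := by
    rintro p q ⟨w⟩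
    induction w with
    | nil => exact Reachable.refl _
    | cons h _ ih =>
      rcases boxProd_adj.1 (hT h) with ⟨-, h⟩ | ⟨h, -⟩
      · rwa [h]
      · exact h.reachable.trans ih
  obtain ⟨x⟩ := ‹Nonempty V›
  refine Infinite.of_surjective (α := T.ConnectedComponent) (β := Y.ConnectedComponent)
    (Quot.lift (fun p => Y.connectedComponentMk p.2) fun p q h =>
      ConnectedComponent.sound (key h)) ?_
  intro C
  induction C using ConnectedComponent.ind with
  | h y => exact ⟨T.connectedComponentMk (x, y), rfl⟩

/-- A walk of the product stays in a ball around the second coordinate of its starting point. -/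
lemma exists_reachable_within {X : SimpleGraph V} {Y : SimpleGraph W} {T : SimpleGraph (V × W)}
    (hT : T ≤ X □ Y) {p q : V × W} (h : T.Reachable p q) :
    ∃ R, (T.within {z | z.2 ∈ Y.closedBall p.2 R}).Reachable p q := by
  obtain ⟨w⟩ := h
  induction w with
  | nil => exact ⟨0, Reachable.refl _⟩
  | @cons p p' q h _ ih =>
    obtain ⟨R, hR⟩ := ih
    have hball : p'.2 ∈ Y.closedBall p.2 1 := by
      rcases boxProd_adj.1 (hT h) with ⟨-, h⟩ | ⟨h, -⟩
      · rw [h]; exact Y.mem_closedBall_self _ _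
      · exact ⟨h.toWalk, by simp⟩
    refine ⟨1 + R, (Adj.reachable ?_).trans (hR.mono (T.within_mono ?_))⟩
    · exact ⟨h, Y.mem_closedBall_self _ _, Y.closedBall_mono _ (by omega) hball⟩
    · exact fun z hz => mem_closedBall_add hball hz

end SimpleGraph

/-! ### The mass transport principle -/

namespace SimpleGraph

section MassTransport

open scoped ENNReal

universe u

variable {V : Type u} {X : SimpleGraph V} {G : Subgroup (X ≃g X)}

lemma isOpen_setOf_apply_eq (o y : V) : IsOpen {g : G | (g : X ≃g X) o = y} := by
  let : TopologicalSpace V := ⊥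
  have : DiscreteTopology V := ⟨rfl⟩
  have h₁ : Continuous fun g : X ≃g X => (g : V → V) := continuous_induced_dom
  have h₂ : Continuous fun g : G => ((g : X ≃g X) : V → V) o :=
    (continuous_apply o).comp (h₁.comp continuous_subtype_val)
  exact (isOpen_discrete ({y} : Set V)).preimage h₂

/-- Pointwise stabilizers of finite sets form a neighbourhood basis at the identity. -/
lemma exists_finset_fixing_subset {U : Set G} (hU : IsOpen U) (h1 : (1 : G) ∈ U) :
    ∃ F : Finset V, {g : G | ∀ v ∈ F, (g : X ≃g X) v = v} ⊆ U := by
  let : TopologicalSpace V := ⊥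
  have : DiscreteTopology V := ⟨rfl⟩
  obtain ⟨U', hU', rfl⟩ := isOpen_induced_iff.1 hU
  obtain ⟨O, hO, rfl⟩ := isOpen_induced_iff.1 hU'
  obtain ⟨F, u, hu, hF⟩ := isOpen_pi_iff.1 hO _ h1
  refine ⟨F, fun g hg => hF fun v hv => ?_⟩
  have : (g : X ≃g X) v = v := hg v hv
  change (g : X ≃g X) v ∈ u v
  rw [this]
  exact (hu v hv).2

variable [MeasurableSpace G] [BorelSpace G] (μ : Measure G)

instance measurableMul_aut : MeasurableMul G where
  measurable_const_mul a := by
    let : TopologicalSpace V := ⊥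
    have : DiscreteTopology V := ⟨rfl⟩
    refine Continuous.measurable (continuous_induced_rng.2 (continuous_induced_rng.2
      (continuous_pi fun x => ?_)))
    have h₁ : Continuous fun g : X ≃g X => (g : V → V) := continuous_induced_dom
    exact (continuous_of_discreteTopology (f := (a : X ≃g X))).comp
      ((continuous_apply x).comp (h₁.comp continuous_subtype_val))
  measurable_mul_const a := by
    let : TopologicalSpace V := ⊥
    have h₁ : Continuous fun g : X ≃g X => (g : V → V) := continuous_induced_dom
    exact Continuous.measurable (continuous_induced_rng.2 (continuous_induced_rng.2
      (continuous_pi fun x =>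
        (continuous_apply ((a : X ≃g X) x)).comp (h₁.comp continuous_subtype_val))))

/-- Some neighbourhood of 1 has finite measure and contains the pointwise stabilizer of a finite set
`F`. An element fixing `o` moves each point of `F` within a finite ball about `o`, so finitely many
left translates of that neighbourhood cover the stabilizer of `o`. -/
lemma haar_stabilizer_ne_top [μ.IsHaarMeasure] [μ.Regular] (hX : X.Connected)
    (hfin : ∀ v, (X.neighborSet v).Finite) (o : V) : μ {g : G | (g : X ≃g X) o = o} ≠ ∞ := by
  have h1 : μ {(1 : G)} < ∞ := isCompact_singleton.measure_lt_top
  obtain ⟨U, h1U, hUo, hUlt⟩ := Set.exists_isOpen_lt_of_lt {(1 : G)} ∞ h1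
  obtain ⟨F, hF⟩ := exists_finset_fixing_subset hUo (h1U rfl)
  choose d hd using fun v : V => (⟨(hX o v).some.length, (hX o v).some, le_rfl⟩ :
    ∃ n, v ∈ X.closedBall o n)
  have hΦ : (Set.univ.pi fun v : F => X.closedBall o (d v)).Finite :=
    Set.Finite.pi fun v => finite_closedBall hfin o (d v)
  have hcover : {g : G | (g : X ≃g X) o = o} ⊆
      ⋃ φ ∈ Set.univ.pi fun v : F => X.closedBall o (d v),
        {g : G | ∀ v : F, (g : X ≃g X) v = φ v} := by
    intro g hg
    refine Set.mem_iUnion₂.2 ⟨fun v => (g : X ≃g X) v, fun v _ => ?_, fun v => rfl⟩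
    have := (map_mem_closedBall (g : X ≃g X)).2 (hd v)
    rwa [show (g : X ≃g X) o = o from hg] at this
  refine ((measure_mono hcover).trans_lt (measure_biUnion_lt_top hΦ fun φ _ => ?_)).ne
  rcases Set.eq_empty_or_nonempty {g : G | ∀ v : F, (g : X ≃g X) v = φ v} with h | ⟨g₀, hg₀⟩
  · rw [h]; simp
  · refine lt_of_le_of_lt (measure_mono (t := (fun g => g₀⁻¹ * g) ⁻¹' U) ?_) ?_
    · intro g hg
      refine hF fun v hv => ?_
      have h₁ : (g : X ≃g X) v = (g₀ : X ≃g X) v := (hg ⟨v, hv⟩).trans (hg₀ ⟨v, hv⟩).symm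
      change (g₀ : X ≃g X).symm ((g : X ≃g X) v) = v
      rw [h₁, RelIso.symm_apply_apply]
    · rwa [measure_preimage_mul]

omit [BorelSpace G] in
lemma haar_stabilizer_ne_zero [μ.IsHaarMeasure] (o : V) :
    μ {g : G | (g : X ≃g X) o = o} ≠ 0 :=
  (isOpen_setOf_apply_eq o o).measure_ne_zero μ ⟨1, rfl⟩

lemma haar_setOf_apply_eq [μ.IsMulLeftInvariant] (o : V) (a : G) :
    μ {g : G | (g : X ≃g X) o = (a : X ≃g X) o} = μ {g : G | (g : X ≃g X) o = o} := by
  rw [← measure_preimage_mul μ a⁻¹ {g : G | (g : X ≃g X) o = o}]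
  congr 1
  ext g
  exact ((a : X ≃g X).symm_apply_eq (x := (g : X ≃g X) o) (y := o)).symm

/-- This set is a right coset of the stabilizer; here right-invariance, hence unimodularity, is
used. -/
lemma haar_setOf_symm_apply_eq [μ.IsMulRightInvariant] (o : V) (a : G) :
    μ {g : G | (g : X ≃g X).symm o = (a : X ≃g X).symm o} =
      μ {g : G | (g : X ≃g X) o = o} := by
  rw [← measure_preimage_mul_right μ a⁻¹ {g : G | (g : X ≃g X) o = o}]
  congr 1
  ext g
  change (g : X ≃g X).symm o = (a : X ≃g X).symm o ↔ (g : X ≃g X) ((a : X ≃g X).symm o) = o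
  rw [RelIso.symm_apply_eq, eq_comm]

/-- The mass transport principle between the orbits of two vertices. -/
lemma massTransport_orbit [Countable V] [μ.IsHaarMeasure] [μ.IsMulRightInvariant]
    (F : V → V → ℝ≥0∞) (hF : ∀ (g : G) x y, F ((g : X ≃g X) x) ((g : X ≃g X) y) = F x y)
    (o o' : V) :
    (∑' y, F o y * (MulAction.orbit G o').indicator 1 y) * μ {g : G | (g : X ≃g X) o' = o'} =
      (∑' x, F x o' * (MulAction.orbit G o).indicator 1 x) * μ {g : G | (g : X ≃g X) o = o} := by
  let : MeasurableSpace V := ⊤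
  have hm₁ : Measurable fun g : G => (g : X ≃g X) o' :=
    measurable_to_countable' fun y => (isOpen_setOf_apply_eq o' y).measurableSet
  have hm₂ : Measurable fun g : G => (g : X ≃g X).symm o := by
    refine measurable_to_countable' fun y => ?_
    convert (isOpen_setOf_apply_eq (G := G) y o).measurableSet using 1
    ext g
    change (g : X ≃g X).symm o = y ↔ (g : X ≃g X) y = o
    rw [RelIso.symm_apply_eq, eq_comm]
  -- Since `F o (g o') = F (g⁻¹ o) o'`, one integral over `G` is evaluated in two ways, by the
  -- position of `g o'` and by that of `g⁻¹ o`.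
  have h₁ : ∫⁻ g : G, F o ((g : X ≃g X) o') ∂μ =
      (∑' y, F o y * (MulAction.orbit G o').indicator 1 y) *
        μ {g : G | (g : X ≃g X) o' = o'} := by
    rw [← lintegral_map (f := fun y => F o y) measurable_from_top hm₁, lintegral_countable',
      ← ENNReal.tsum_mul_right]
    refine tsum_congr fun y => ?_
    rw [Measure.map_apply hm₁ (MeasurableSet.singleton y), mul_assoc]
    congr 1
    by_cases hy : y ∈ MulAction.orbit G o'
    · obtain ⟨a, rfl⟩ := hy
      rw [Set.indicator_of_mem (MulAction.mem_orbit _ a), Pi.one_apply, one_mul]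
      exact haar_setOf_apply_eq μ o' a
    · rw [Set.indicator_of_notMem hy, zero_mul]
      convert measure_empty (μ := μ)
      ext g
      simp only [Set.mem_preimage, Set.mem_singleton_iff, Set.mem_empty_iff_false, iff_false]
      rintro rfl
      exact hy ⟨g, rfl⟩
  have h₂ : ∫⁻ g : G, F ((g : X ≃g X).symm o) o' ∂μ =
      (∑' x, F x o' * (MulAction.orbit G o).indicator 1 x) *
        μ {g : G | (g : X ≃g X) o = o} := by
    rw [← lintegral_map (f := fun y => F y o') measurable_from_top hm₂, lintegral_countable',
      ← ENNReal.tsum_mul_right]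
    refine tsum_congr fun y => ?_
    rw [Measure.map_apply hm₂ (MeasurableSet.singleton y), mul_assoc]
    congr 1
    by_cases hy : y ∈ MulAction.orbit G o
    · obtain ⟨a, rfl⟩ := hy
      rw [Set.indicator_of_mem (MulAction.mem_orbit _ a), Pi.one_apply, one_mul]
      exact haar_setOf_symm_apply_eq μ o a⁻¹
    · rw [Set.indicator_of_notMem hy, zero_mul]
      convert measure_empty (μ := μ)
      ext g
      simp only [Set.mem_preimage, Set.mem_singleton_iff, Set.mem_empty_iff_false, iff_false]
      rintro rfl
      exact hy ⟨g⁻¹, rfl⟩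
  rw [← h₁, ← h₂]
  refine lintegral_congr fun g => ?_
  rw [← hF g ((g : X ≃g X).symm o) o', RelIso.apply_symm_apply]

omit [MeasurableSpace G] [BorelSpace G] in
/-- The mass transport principle for quasi-transitive unimodular groups of automorphisms. -/
theorem exists_massTransport [Countable V] (hX : X.Connected)
    (hfin : ∀ v, (X.neighborSet v).Finite) (hqt : IsQuasiTransitive G)
    (huni : IsUnimodularGroup G) :
    ∃ (I : Type u) (_ : Fintype I) (_ : Nonempty I) (o : I → V) (w : I → ℝ≥0∞),
      (∀ i, w i ≠ 0) ∧ (∀ i, w i ≠ ∞) ∧ (∀ v, ∃ i, ∃ g ∈ G, g (o i) = v) ∧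
      ∀ F : V → V → ℝ≥0∞, (∀ g ∈ G, ∀ x y, F (g x) (g y) = F x y) →
        ∑ i, w i * ∑' y, F (o i) y = ∑ i, w i * ∑' x, F x (o i) := by
  let : MeasurableSpace G := borel G
  have : BorelSpace G := ⟨rfl⟩
  obtain ⟨μ, _, _, _⟩ := huni
  have : Finite (MulAction.orbitRel.Quotient G V) := hqt
  have hcov (v : V) : v ∈ MulAction.orbit G
      (Quotient.out (s := MulAction.orbitRel G V) (Quotient.mk (MulAction.orbitRel G V) v)) :=
    MulAction.orbitRel_apply.1
      ((MulAction.orbitRel G V).symm (Quotient.mk_out (s := MulAction.orbitRel G V) v))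
  refine ⟨MulAction.orbitRel.Quotient G V, Fintype.ofFinite _,
    ⟨Quotient.mk _ hX.nonempty.some⟩, fun q => Quotient.out q,
    -- Weighting an orbit by the inverse Haar measure of a stabilizer cancels the factors in
    -- `massTransport_orbit`.
    fun q => (μ {g : G | (g : X ≃g X) (Quotient.out q) = Quotient.out q})⁻¹,
    fun q => ENNReal.inv_ne_zero.2 (haar_stabilizer_ne_top μ hX hfin _),
    fun q => ENNReal.inv_ne_top.2 (haar_stabilizer_ne_zero μ _), fun v => ?_, fun F hF => ?_⟩
  · obtain ⟨g, hg⟩ := hcov v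
    exact ⟨_, g, g.2, hg⟩
  · let : Fintype (MulAction.orbitRel.Quotient G V) := Fintype.ofFinite _
    have hsum (y : V) : ∑ q : MulAction.orbitRel.Quotient G V,
        (MulAction.orbit G (Quotient.out q)).indicator (1 : V → ℝ≥0∞) y = 1 := by
      rw [Finset.sum_eq_single (Quotient.mk _ y), Set.indicator_of_mem (hcov y), Pi.one_apply]
      · intro q _ hq
        refine Set.indicator_of_notMem (fun h => hq ?_) _
        rw [← Quotient.out_eq q]
        exact (Quotient.sound (s := MulAction.orbitRel G V) h).symm
      · exact fun h => absurd (Finset.mem_univ _) h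
    have hsplit (f : V → ℝ≥0∞) : ∑' y, f y = ∑ q : MulAction.orbitRel.Quotient G V,
        ∑' y, f y * (MulAction.orbit G (Quotient.out q)).indicator 1 y := by
      rw [← Summable.tsum_finsetSum fun _ _ => ENNReal.summable]
      refine tsum_congr fun y => ?_
      rw [← Finset.mul_sum, hsum, mul_one]
    conv_lhs => enter [2, q]; rw [hsplit, Finset.mul_sum]
    conv_rhs => enter [2, q]; rw [hsplit, Finset.mul_sum]
    rw [Finset.sum_comm]
    refine Finset.sum_congr rfl fun q' _ => Finset.sum_congr rfl fun q _ => ?_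
    have key := massTransport_orbit μ F (fun g x y => hF g g.2 x y)
      (Quotient.out q) (Quotient.out q')
    have h₁ := haar_stabilizer_ne_top μ hX hfin (Quotient.out q)
    have h₂ := haar_stabilizer_ne_top μ hX hfin (Quotient.out q')
    have h₃ := haar_stabilizer_ne_zero μ (Quotient.out q)
    have h₄ := haar_stabilizer_ne_zero μ (Quotient.out q')
    set a := ∑' y, F (Quotient.out q) y * (MulAction.orbit G (Quotient.out q')).indicator 1 y
    set b := ∑' x, F x (Quotient.out q') * (MulAction.orbit G (Quotient.out q)).indicator 1 x
    have ha : a = b * μ {g : G | (g : X ≃g X) (Quotient.out q) = Quotient.out q} *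
        (μ {g : G | (g : X ≃g X) (Quotient.out q') = Quotient.out q'})⁻¹ := by
      rw [← key, mul_assoc, ENNReal.mul_inv_cancel h₄ h₂, mul_one]
    rw [ha, mul_comm b, mul_assoc, ← mul_assoc, ENNReal.inv_mul_cancel h₃ h₁, one_mul, mul_comm]

end MassTransport

end SimpleGraph

/-! ### The free minimal spanning forest and its labels -/

namespace SimpleGraph

section MinimalSpanningForest

variable {N : Type*} {Z : SimpleGraph N}

/-- The subgraph of edges whose label is lower than `t`. -/
def sublevelGraph (Z : SimpleGraph N) (U : Z.edgeSet → ℝ) (t : ℝ) : SimpleGraph N where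
  Adj u v := ∃ h : s(u, v) ∈ Z.edgeSet, U ⟨s(u, v), h⟩ < t
  symm := ⟨fun u v ⟨h, ht⟩ => by
    have hs : s(v, u) = s(u, v) := Sym2.eq_swap
    exact ⟨hs ▸ h, by simpa only [hs] using ht⟩⟩
  loopless := ⟨fun u ⟨h, _⟩ => Z.loopless.irrefl u h⟩

lemma sublevelGraph_le (U : Z.edgeSet → ℝ) (t : ℝ) : Z.sublevelGraph U t ≤ Z :=
  fun _ _ h => h.1

lemma exists_of_mem_edgeSet_sublevelGraph {U : Z.edgeSet → ℝ} {t : ℝ} {e : Sym2 N}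
    (he : e ∈ (Z.sublevelGraph U t).edgeSet) : ∃ h : e ∈ Z.edgeSet, U ⟨e, h⟩ < t := by
  induction e with
  | h a b => exact he

/-- Reachability in a sublevel graph replaces paths with low labels; measurability and equivariance
are easier in this form. -/
lemma freeMinimalSpanningForest_adj {U : Z.edgeSet → ℝ} {u v : N} :
    (Z.freeMinimalSpanningForest U).Adj u v ↔
      ∃ h : s(u, v) ∈ Z.edgeSet, ¬ (Z.sublevelGraph U (U ⟨s(u, v), h⟩)).Reachable u v := by
  classical
  refine exists_congr fun h => not_congr ⟨?_, ?_⟩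
  · rintro ⟨p, -, hp⟩
    refine ⟨p.transfer _ fun e he => ?_⟩
    have hlt := hp e he
    have heZ := p.edges_subset_edgeSet he
    induction e with
    | h a b => exact ⟨heZ, hlt⟩
  · rintro ⟨p⟩
    refine ⟨p.bypass.mapLe (sublevelGraph_le U _), p.bypass_isPath.mapLe _, fun e he => ?_⟩
    rw [Walk.edges_mapLe_eq_edges] at he
    exact (exists_of_mem_edgeSet_sublevelGraph (p.bypass.edges_subset_edgeSet he)).2

lemma freeMinimalSpanningForest_le (U : Z.edgeSet → ℝ) : Z.freeMinimalSpanningForest U ≤ Z :=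
  fun _ _ h => h.1

lemma freeMinimalSpanningForest_relabel (φ : Z ≃g Z) (U : Z.edgeSet → ℝ) :
    Z.freeMinimalSpanningForest (fun e => U (φ.mapEdgeSet e)) =
      (Z.freeMinimalSpanningForest U).comap φ := by
  have hsub (t : ℝ) : Z.sublevelGraph (fun e => U (φ.mapEdgeSet e)) t =
      (Z.sublevelGraph U t).comap φ.toEquiv := by
    ext a b
    exact ⟨fun ⟨h, ht⟩ => ⟨φ.map_adj_iff.2 h, ht⟩, fun ⟨h, ht⟩ => ⟨φ.map_adj_iff.1 h, ht⟩⟩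
  ext u v
  rw [comap_adj, freeMinimalSpanningForest_adj, freeMinimalSpanningForest_adj]
  constructor
  · rintro ⟨h, hr⟩
    rw [hsub, reachable_comap_equiv] at hr
    exact ⟨φ.map_adj_iff.2 h, hr⟩
  · rintro ⟨h, hr⟩
    refine ⟨φ.map_adj_iff.1 h, ?_⟩
    rw [hsub, reachable_comap_equiv]
    exact hr

lemma measurable_freeMinimalSpanningForest_adj [Countable N] (u v : N) :
    Measurable fun U : Z.edgeSet → ℝ => (Z.freeMinimalSpanningForest U).Adj u v := by
  simp only [freeMinimalSpanningForest_adj]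
  refine Measurable.exists fun h => (measurable_reachable (fun a b => ?_) u v).not
  exact Measurable.exists fun h' => measurableSet_setOfPred.1
    (measurableSet_lt (measurable_pi_apply _) (measurable_pi_apply _))

/-- The edge of largest label on a cycle cannot be retained: the rest of the cycle joins its
endpoints, with strictly lower labels by injectivity. -/
lemma isAcyclic_freeMinimalSpanningForest {U : Z.edgeSet → ℝ} (hU : Function.Injective U) :
    (Z.freeMinimalSpanningForest U).IsAcyclic := by
  classical
  intro v c hc
  have hZ : ∀ e ∈ c.edges, e ∈ Z.edgeSet := fun e he =>
    edgeSet_mono (freeMinimalSpanningForest_le U) (c.edges_subset_edgeSet he)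
  let f : Sym2 N → ℝ := fun e => if h : e ∈ Z.edgeSet then U ⟨e, h⟩ else 0
  have hf {e : Sym2 N} (h : e ∈ Z.edgeSet) : f e = U ⟨e, h⟩ := dif_pos h
  have hne : c.edges.toFinset.Nonempty := by
    rw [List.toFinset_nonempty_iff]
    intro h
    exact hc.ne_nil (Walk.edges_eq_nil.1 h).eq_nil
  obtain ⟨e, he, hmax⟩ := Finset.exists_max_image _ f hne
  rw [List.mem_toFinset] at he
  induction e with
  | h a b =>
    obtain ⟨hab, hr⟩ := freeMinimalSpanningForest_adj.1 (c.edges_subset_edgeSet he)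
    refine hr ?_
    have hc' : ∀ e ∈ c.edges, e ∈ (fromEdgeSet {e | e ∈ c.edges}).edgeSet := fun e he => by
      rw [edgeSet_fromEdgeSet]
      exact ⟨he, fun h => Z.not_isDiag_of_mem_edgeSet (hZ e he) h⟩
    have hreach := (adj_and_reachable_delete_edges_iff_exists_cycle.2
      ⟨v, c.transfer _ hc', hc.transfer hc', by rwa [Walk.edges_transfer]⟩).2
    refine hreach.mono ?_
    intro x y hxy
    rw [deleteEdges_adj, fromEdgeSet_adj] at hxy
    obtain ⟨⟨hxy, -⟩, hne⟩ := hxy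
    refine ⟨hZ _ hxy, lt_of_le_of_ne ?_ fun h => hne ?_⟩
    · rw [← hf, ← hf]
      exact hmax _ (List.mem_toFinset.2 hxy)
    · exact Subtype.ext_iff.1 (hU h)

end MinimalSpanningForest

end SimpleGraph

lemma ae_injective_infinitePi {ι : Type*} [Countable ι] (μ : Measure ℝ) [IsProbabilityMeasure μ]
    [NullSingletonClass μ] : ∀ᵐ U ∂(Measure.infinitePi fun _ : ι => μ), Function.Injective U := by
  have key : ∀ i j : ι, i ≠ j → ∀ᵐ U ∂(Measure.infinitePi fun _ : ι => μ), U i ≠ U j := by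
    intro i j hij
    have hmap := Measure.infinitePi_map_eval_prod (P := fun _ : ι => μ) hij
    have hd : MeasurableSet {p : ℝ × ℝ | p.1 = p.2} := measurableSet_eq_fun measurable_fst
      measurable_snd
    have h0 : (μ.prod μ) {p : ℝ × ℝ | p.1 = p.2} = 0 := by
      rw [Measure.measure_prod_null hd]
      refine Filter.Eventually.of_forall fun x => ?_
      have : Prod.mk x ⁻¹' {p : ℝ × ℝ | p.1 = p.2} = {x} := by
        ext y; exact eq_comm
      change μ (Prod.mk x ⁻¹' {p : ℝ × ℝ | p.1 = p.2}) = 0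
      rw [this]
      exact measure_singleton x
    rw [← hmap, Measure.map_apply (by fun_prop) hd] at h0
    exact measure_eq_zero_iff_ae_notMem.1 h0
  have h := ae_all_iff.2 fun i => ae_all_iff.2 fun j => Filter.eventually_imp_distrib_left.2 (key i j)
  filter_upwards [h] with U hU i j hij
  by_contra hne
  exact hU i j hne hij

lemma measurePreserving_relabel {ι : Type*} (μ : Measure ℝ) [IsProbabilityMeasure μ]
    (σ : ι ≃ ι) : MeasurePreserving (fun (U : ι → ℝ) i => U (σ i))
      (Measure.infinitePi fun _ : ι => μ) (Measure.infinitePi fun _ : ι => μ) :=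
  ⟨by fun_prop, Measure.map_infinitePi_infinitePi_of_inj (P := fun _ : ι => μ) σ.injective⟩

/-! ### Cells and exits: equivariance and measurability -/

namespace SimpleGraph

open scoped ENNReal

variable {V W : Type*}

section Cells

/-- `x` and `x'` are connected within the slab `V × B` when lifted to height `y`. -/
def SlabRel (T : SimpleGraph (V × W)) (B : Set W) (y : W) (x x' : V) : Prop :=
  (T.within {z | z.2 ∈ B}).Reachable (x, y) (x', y)

/-- `x` and `x'` are connected within each slab `V × B i` when lifted to height `y i`. -/
def CellRel {ι : Type*} (T : SimpleGraph (V × W)) (B : ι → Set W) (y : ι → W) (x x' : V) : Prop :=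
  ∀ i, T.SlabRel (B i) (y i) x x'

/-- `x'` is the first coordinate of a vertex through which one can leave the component of `(x, y)`
within the slab `V × B` in order to reach `(x, y')` without ever coming back. -/
def IsExit (T : SimpleGraph (V × W)) (B : Set W) (y y' : W) (x x' : V) : Prop :=
  ∃ w b, (T.within {z | z.2 ∈ B}).Reachable (x, y) (x', w) ∧
    ¬ (T.within {z | z.2 ∈ B}).Reachable (x, y) b ∧ T.Adj (x', w) b ∧
    (T.within {v | ¬ (T.within {z | z.2 ∈ B}).Reachable (x, y) v}).Reachable b (x, y')

/-- The graph `T` has at most `k` connected components. -/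
def HasAtMostComponents {N : Type*} (T : SimpleGraph N) (k : ℕ) : Prop :=
  ∃ f : Fin k → N, ∀ p, ∃ i, T.Reachable p (f i)

lemma exists_hasAtMostComponents {N : Type*} {T : SimpleGraph N}
    (h : ¬ Infinite T.ConnectedComponent) : ∃ k, T.HasAtMostComponents k := by
  rw [not_infinite_iff_finite] at h
  obtain ⟨k, ⟨e⟩⟩ := Finite.exists_equiv_fin T.ConnectedComponent
  choose f hf using fun i => (e.symm i).exists_rep
  refine ⟨k, f, fun p => ⟨e (T.connectedComponentMk p), ConnectedComponent.exact ?_⟩⟩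
  exact (e.symm_apply_apply _).symm.trans (hf _).symm

lemma HasAtMostComponents.exists_coloring {N : Type*} {T : SimpleGraph N} {k : ℕ}
    (h : T.HasAtMostComponents k) :
    ∃ col : N → Fin k, ∀ p q, col p = col q → T.Reachable p q := by
  obtain ⟨f, hf⟩ := h
  choose col hcol using hf
  exact ⟨col, fun p q hpq => (hcol p).trans (hpq ▸ (hcol q).symm)⟩

lemma hasAtMostComponents_comap {N : Type*} {T : SimpleGraph N} (γ : N ≃ N) {k : ℕ} :
    (T.comap γ).HasAtMostComponents k ↔ T.HasAtMostComponents k := by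
  simp only [HasAtMostComponents, reachable_comap_equiv]
  constructor
  · rintro ⟨f, hf⟩
    refine ⟨γ ∘ f, fun p => ?_⟩
    obtain ⟨i, hi⟩ := hf (γ.symm p)
    exact ⟨i, by simpa using hi⟩
  · rintro ⟨f, hf⟩
    exact ⟨γ.symm ∘ f, fun p => by simpa using hf (γ p)⟩

variable {T : SimpleGraph (V × W)} {ι : Type*} {B : ι → Set W} {y : ι → W} {x x' x'' : V}

lemma CellRel.refl (x : V) : T.CellRel B y x x := fun _ => Reachable.refl _

lemma CellRel.symm (h : T.CellRel B y x x') : T.CellRel B y x' x := fun i => (h i).symm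

lemma CellRel.trans (h : T.CellRel B y x x') (h' : T.CellRel B y x' x'') : T.CellRel B y x x'' :=
  fun i => (h i).trans (h' i)

lemma CellRel.setOf_eq (h : T.CellRel B y x x') :
    {z | T.CellRel B y x z} = {z | T.CellRel B y x' z} :=
  Set.ext fun _ => ⟨fun hz => h.symm.trans hz, fun hz => h.trans hz⟩

/-- The slab components of `(x, y i)` and `(x', y i)` coincide, and the targets `(x, y j)`, `(x', y
j)` are joined inside `V × B j`, which is disjoint from that component. -/
lemma IsExit.congr {i j : ι} (hdis : Disjoint (B i) (B j)) (hi : y i ∈ B i) (h : T.CellRel B y x x')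
    (he : T.IsExit (B i) (y i) (y j) x x'') : T.IsExit (B i) (y i) (y j) x' x'' := by
  obtain ⟨w, b, h₁, h₂, h₃, h₄⟩ := he
  have hiff (v : V × W) : (T.within {z | z.2 ∈ B i}).Reachable (x', y i) v ↔
      (T.within {z | z.2 ∈ B i}).Reachable (x, y i) v :=
    ⟨fun hv => (h i).trans hv, fun hv => (h i).symm.trans hv⟩
  refine ⟨w, b, (hiff _).2 h₁, fun hb => h₂ ((hiff _).1 hb), h₃, ?_⟩
  simp only [hiff]
  refine h₄.trans ((h j).mono (T.within_mono ?_))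
  intro z hz hz'
  exact Set.disjoint_left.1 hdis (hz'.mem_of_within hi) hz

lemma IsExit.unique (hT : T.IsAcyclic) {B : Set W} {y y' : W} (hy : y ∈ B) {a a' : V}
    (h : T.IsExit B y y' x a) (h' : T.IsExit B y y' x a') : a = a' := by
  obtain ⟨w, b, h₁, h₂, h₃, h₄⟩ := h
  obtain ⟨w', b', h₁', h₂', h₃', h₄'⟩ := h'
  exact congrArg Prod.fst (exit_unique hT (by exact hy) h₁ h₁' h₃ h₃' h₂ h₄ h₄')

lemma exists_isExit {B : Set W} {y y' : W} (hy : y ∈ B) (hy' : y' ∉ B)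
    (h : T.Reachable (x, y) (x, y')) : ∃ x', T.IsExit B y y' x x' := by
  obtain ⟨⟨x', w⟩, b, h₁, h₂, h₃, h₄⟩ := exists_exit
    (A := {v | (T.within {z | z.2 ∈ B}).Reachable (x, y) v}) (s := (x, y)) (t := (x, y'))
    (Reachable.refl _) (fun h => hy' (Reachable.mem_of_within (A := {z : V × W | z.2 ∈ B}) h hy)) h
  exact ⟨x', w, b, h₁, h₂, h₃, h₄⟩

end Cells

section Equivariance

variable {T : SimpleGraph (V × W)} {ι : Type*} {B : ι → Set W} {y : ι → W} {x x' : V}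

lemma slabRel_comap_left (g : V ≃ V) {B : Set W} {y : W} :
    (T.comap (g.prodCongr (Equiv.refl W))).SlabRel B y x x' ↔ T.SlabRel B y (g x) (g x') :=
  reachable_comap_equiv (T := T.within {z | z.2 ∈ B}) (g.prodCongr (Equiv.refl W))

lemma slabRel_comap_right (h : W ≃ W) {B : Set W} {y : W} :
    (T.comap ((Equiv.refl V).prodCongr h)).SlabRel (h ⁻¹' B) y x x' ↔ T.SlabRel B (h y) x x' :=
  reachable_comap_equiv (T := T.within {z | z.2 ∈ B}) ((Equiv.refl V).prodCongr h)

lemma cellRel_comap (g : V ≃ V) :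
    (T.comap (g.prodCongr (Equiv.refl W))).CellRel B y x x' ↔ T.CellRel B y (g x) (g x') :=
  forall_congr' fun _ => slabRel_comap_left g

lemma setOf_cellRel_comap (g : V ≃ V) :
    {z | (T.comap (g.prodCongr (Equiv.refl W))).CellRel B y x z} =
      g ⁻¹' {z | T.CellRel B y (g x) z} :=
  Set.ext fun _ => cellRel_comap g

lemma isExit_comap (g : V ≃ V) {B : Set W} {y y' : W} :
    (T.comap (g.prodCongr (Equiv.refl W))).IsExit B y y' x x' ↔
      T.IsExit B y y' (g x) (g x') := by
  have hr (u v : V × W) : ((T.comap (g.prodCongr (Equiv.refl W))).within {z | z.2 ∈ B}).Reachable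
      u v ↔ (T.within {z | z.2 ∈ B}).Reachable (g.prodCongr (Equiv.refl W) u)
        (g.prodCongr (Equiv.refl W) v) :=
    reachable_comap_equiv (T := T.within {z | z.2 ∈ B}) (g.prodCongr (Equiv.refl W))
  refine exists_congr fun w => ?_
  refine Iff.trans ?_ (g.prodCongr (Equiv.refl W)).surjective.exists.symm
  refine exists_congr fun b => and_congr (hr _ _) (and_congr (not_congr (hr _ _))
    (and_congr Iff.rfl ?_))
  simp only [hr]
  exact reachable_comap_equiv
    (T := T.within {v | ¬ (T.within {z | z.2 ∈ B}).Reachable (g x, y) v})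
    (g.prodCongr (Equiv.refl W))

end Equivariance

section Measurability

variable {Λ : Type*} [MeasurableSpace Λ] [Countable V] [Countable W]
  {T : Λ → SimpleGraph (V × W)} (hT : ∀ u v, Measurable fun U => (T U).Adj u v)
include hT

lemma measurable_slabRel (B : Set W) (y : W) (x x' : V) :
    Measurable fun U => (T U).SlabRel B y x x' :=
  measurable_reachable (fun u v => (hT u v).and measurable_const) _ _

lemma measurable_cellRel {ι : Type*} [Countable ι] (B : ι → Set W) (y : ι → W) (x x' : V) :
    Measurable fun U => (T U).CellRel B y x x' :=
  Measurable.forall fun i => measurable_slabRel hT (B i) (y i) x x'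

lemma measurable_isExit (B : Set W) (y y' : W) (x x' : V) :
    Measurable fun U => (T U).IsExit B y y' x x' := by
  have hr (v : V × W) :
      Measurable fun U => ((T U).within {z | z.2 ∈ B}).Reachable (x, y) v :=
    measurable_reachable (fun u v => (hT u v).and measurable_const) _ _
  exact Measurable.exists fun w => Measurable.exists fun b =>
    (hr _).and ((hr b).not.and ((hT _ b).and
      (measurable_reachable (fun u v => (hT u v).and ((hr u).not.and (hr v).not)) _ _)))

lemma measurable_hasAtMostComponents (k : ℕ) :
    Measurable fun U => (T U).HasAtMostComponents k :=
  Measurable.exists fun _ => Measurable.forall fun _ => Measurable.exists fun _ =>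
    measurable_reachable hT _ _

omit hT in
lemma measurable_infinite {C : Λ → Set V} (hC : ∀ z, Measurable fun U => z ∈ C U) :
    Measurable fun U => (C U).Infinite := by
  have : (fun U => (C U).Infinite) = fun U => ∀ F : Finset V, ∃ z, z ∉ F ∧ z ∈ C U := by
    ext U
    constructor
    · intro h F
      obtain ⟨z, hz, hzF⟩ := h.exists_notMem_finset F
      exact ⟨z, hzF, hz⟩
    · intro h hfin
      obtain ⟨z, hz, hzC⟩ := h hfin.toFinset
      exact hz (hfin.mem_toFinset.2 hzC)
  rw [this]
  exact Measurable.forall fun F => Measurable.exists fun z => measurable_const.and (hC z)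

end Measurability

lemma tsum_ite_mem (s : Set V) [DecidablePred (· ∈ s)] (a : ℝ≥0∞) :
    ∑' v, (if v ∈ s then a else 0) = (s.encard : ℝ≥0∞) * a := by
  have : (fun v => if v ∈ s then a else 0) = s.indicator fun _ => a := by
    ext v; simp [Set.indicator_apply]
  rw [this, ← tsum_subtype, ← ENNReal.tsum_set_one, ← ENNReal.tsum_mul_right]
  simp

lemma measurable_encard {Λ : Type*} [MeasurableSpace Λ] [Countable V] {C : Λ → Set V}
    (hC : ∀ z, Measurable fun U => z ∈ C U) :
    Measurable fun U => ((C U).encard : ℝ≥0∞) := by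
  classical
  have : (fun U => ((C U).encard : ℝ≥0∞)) = fun U => ∑' z, if z ∈ C U then 1 else 0 := by
    ext U; rw [tsum_ite_mem, mul_one]
  rw [this]
  exact Measurable.tsum fun z => Measurable.ite (hC z).setOf measurable_const measurable_const

end SimpleGraph

/-! ### Invariant random forests -/

namespace SimpleGraph

open scoped ENNReal

section RandomForest

universe u

variable {V : Type u} {W Λ : Type*} [MeasurableSpace Λ]

/-- The law of the random graph `T` is invariant under the permutation `γ` of the vertices,
as witnessed by a measure preserving transformation of the probability space. -/
def IsInvariantUnder {N : Type*} (ν : Measure Λ) (T : Λ → SimpleGraph N) (γ : N ≃ N) : Prop :=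
  ∃ θ : Λ → Λ, MeasurePreserving θ ν ν ∧ ∀ U, T (θ U) = (T U).comap γ

variable {X : SimpleGraph V} {G : Subgroup (X ≃g X)} {ν : Measure Λ} {T : Λ → SimpleGraph (V × W)}

/-- The mass transport principle for equivariant functions of an invariant random graph. -/
lemma massTransport_random [Countable V] {I : Type u} [Fintype I] {o : I → V} {w : I → ℝ≥0∞}
    (hmt : ∀ F : V → V → ℝ≥0∞, (∀ g ∈ G, ∀ x y, F (g x) (g y) = F x y) →
      ∑ i, w i * ∑' y, F (o i) y = ∑ i, w i * ∑' x, F x (o i))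
    (hG : ∀ g ∈ G, IsInvariantUnder ν T (g.toEquiv.prodCongr (Equiv.refl W)))
    (f : SimpleGraph (V × W) → V → V → ℝ≥0∞) (hf : ∀ x y, Measurable fun U => f (T U) x y)
    (hfG : ∀ g ∈ G, ∀ S x y,
      f (S.comap (g.toEquiv.prodCongr (Equiv.refl W))) x y = f S (g x) (g y)) :
    ∑ i, w i * ∫⁻ U, ∑' y, f (T U) (o i) y ∂ν = ∑ i, w i * ∫⁻ U, ∑' x, f (T U) x (o i) ∂ν := by
  have key := hmt (fun x y => ∫⁻ U, f (T U) x y ∂ν) fun g hg x y => by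
    obtain ⟨θ, hθ, hT⟩ := hG g hg
    rw [← hθ.lintegral_comp (hf x y)]
    simp only [hT, hfG g hg]
  simpa only [lintegral_tsum fun y => (hf _ y).aemeasurable,
    lintegral_tsum fun x => (hf x _).aemeasurable] using key

variable [Countable V] [Countable W] [IsProbabilityMeasure ν]
  (hT : ∀ u v, Measurable fun U => (T U).Adj u v)
  (hac : ∀ᵐ U ∂ν, (T U).IsAcyclic)
  (hG : ∀ g ∈ G, IsInvariantUnder ν T (g.toEquiv.prodCongr (Equiv.refl W)))
  {I : Type u} [Fintype I] {o : I → V} {w : I → ℝ≥0∞}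
  (hw0 : ∀ i, w i ≠ 0) (hwt : ∀ i, w i ≠ ∞)
  (hmt : ∀ F : V → V → ℝ≥0∞, (∀ g ∈ G, ∀ x y, F (g x) (g y) = F x y) →
      ∑ i, w i * ∑' y, F (o i) y = ∑ i, w i * ∑' x, F x (o i))

include hT hac hG hw0 hwt hmt in
/-- Infinite cells cannot single out exits. -/
lemma ae_not_infinite_and_isExit (hcov : ∀ v, ∃ i, ∃ g ∈ G, g (o i) = v)
    {ι : Type*} [Countable ι] {B : ι → Set W} {y : ι → W} {i j : ι}
    (hdis : Disjoint (B i) (B j)) (hy : y i ∈ B i) :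
    ∀ᵐ U ∂ν, ∀ x x', ¬ ({z | (T U).CellRel B y x z}.Infinite ∧
      (T U).IsExit (B i) (y i) (y j) x x') := by
  classical
  set Q : SimpleGraph (V × W) → V → V → Prop := fun S x x' =>
    {z | S.CellRel B y x z}.Infinite ∧ S.IsExit (B i) (y i) (y j) x x'
  have hQm (x x' : V) : Measurable fun U => Q (T U) x x' :=
    (measurable_infinite fun z => measurable_cellRel hT B y x z).and
      (measurable_isExit hT (B i) (y i) (y j) x x')
  have hQG (g : V ≃ V) (S : SimpleGraph (V × W)) (x x' : V) :
      Q (S.comap (g.prodCongr (Equiv.refl W))) x x' ↔ Q S (g x) (g x') := by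
    refine and_congr ?_ (isExit_comap g)
    rw [setOf_cellRel_comap]
    refine not_congr ⟨fun h => Set.Finite.of_preimage h g.surjective,
      fun h => h.preimage g.injective.injOn⟩
  -- Each vertex of an infinite cell sends mass 1 to its exit. At most 1 is sent, by uniqueness of
  -- exits, whereas an exit of an infinite cell receives mass from the entire cell.
  have htr := massTransport_random hmt hG (fun S x x' => if Q S x x' then 1 else 0)
    (fun x x' => Measurable.ite (hQm x x').setOf measurable_const measurable_const)
    (fun g _ S x x' => if_congr (hQG g.toEquiv S x x') rfl rfl)
  have hout (q : I) : ∫⁻ U, ∑' x', (if Q (T U) (o q) x' then 1 else 0) ∂ν ≤ (1 : ℝ≥0∞) := by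
    refine (lintegral_mono_ae (g := fun _ => (1 : ℝ≥0∞)) ?_).trans (by simp)
    filter_upwards [hac] with U hU
    by_cases h : ∃ a, Q (T U) (o q) a
    · obtain ⟨a, ha⟩ := h
      rw [tsum_eq_single a fun a' ha' => if_neg fun h => ha' (h.2.unique hU hy ha.2)]
      exact ite_le_one le_rfl zero_le
    · simp [not_exists.1 h]
  have hin (q : I) : ∀ᵐ U ∂ν, ∀ x, ¬ Q (T U) x (o q) := by
    have hlt : w q * ∫⁻ U, ∑' x, (if Q (T U) x (o q) then 1 else 0) ∂ν ≠ ∞ := by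
      have hle := Finset.single_le_sum
        (f := fun q => w q * ∫⁻ U, ∑' x, (if Q (T U) x (o q) then (1 : ℝ≥0∞) else 0) ∂ν)
        (fun _ _ => zero_le) (Finset.mem_univ q)
      refine ne_top_of_le_ne_top ?_ hle
      rw [← htr]
      refine ENNReal.sum_ne_top.2 fun q _ => ENNReal.mul_ne_top (hwt q) ?_
      exact ne_top_of_le_ne_top ENNReal.one_ne_top (hout q)
    have hlt' : ∫⁻ U, ∑' x, (if Q (T U) x (o q) then (1 : ℝ≥0∞) else 0) ∂ν ≠ ∞ := by
      intro h
      rw [h, ENNReal.mul_top (hw0 q)] at hlt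
      exact hlt rfl
    have hm : Measurable fun U => ∑' x, (if Q (T U) x (o q) then (1 : ℝ≥0∞) else 0) :=
      Measurable.tsum fun x => Measurable.ite (hQm x _).setOf measurable_const measurable_const
    filter_upwards [ae_lt_top hm hlt'] with U hU x hx
    refine hU.ne (top_le_iff.1 ?_)
    have hsub : ∀ z, (if z ∈ {z | (T U).CellRel B y x z} then (1 : ℝ≥0∞) else 0) ≤
        if Q (T U) z (o q) then 1 else 0 := by
      intro z
      by_cases hz : (T U).CellRel B y x z
      · have : Q (T U) z (o q) := ⟨hz.setOf_eq ▸ hx.1, hx.2.congr hdis hy hz⟩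
        simp [this, hz]
      · simp [hz]
    refine le_trans ?_ (ENNReal.tsum_le_tsum hsub)
    rw [tsum_ite_mem, hx.1.encard_eq]
    simp
  -- Invariance carries the conclusion from the representatives `o q` to all vertices.
  refine (ae_all_iff.2 fun x' => ?_ : ∀ᵐ U ∂ν, ∀ x' x, ¬ Q (T U) x x').mono
    fun U hU x x' => hU x' x
  obtain ⟨q, g, hg, rfl⟩ := hcov x'
  obtain ⟨θ, hθ, hTθ⟩ := hG g hg
  filter_upwards [hθ.quasiMeasurePreserving.ae (hin q)] with U hU x hx
  refine hU (g.symm x) ?_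
  rw [hTθ]
  refine (hQG g.toEquiv (T U) _ _).2 ?_
  convert hx
  · exact g.apply_symm_apply x
  · rfl

include hT hac hG hw0 hwt hmt in
/-- If there are at most `k` components, then the cells determined by `k + 1` disjoint slabs
are finite. -/
lemma ae_finite_cells (hcov : ∀ v, ∃ i, ∃ g ∈ G, g (o i) = v) {k : ℕ}
    {B : Fin (k + 1) → Set W} {y : Fin (k + 1) → W}
    (hdis : Pairwise fun i j => Disjoint (B i) (B j)) (hy : ∀ i, y i ∈ B i) :
    ∀ᵐ U ∂ν, (T U).HasAtMostComponents k → ∀ x, {z | (T U).CellRel B y x z}.Finite := by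
  have h : ∀ᵐ U ∂ν, ∀ i j, i ≠ j → ∀ x x', ¬ ({z | (T U).CellRel B y x z}.Infinite ∧
      (T U).IsExit (B i) (y i) (y j) x x') := by
    refine ae_all_iff.2 fun i => ae_all_iff.2 fun j => Filter.eventually_imp_distrib_left.2
      fun hij => ?_
    exact ae_not_infinite_and_isExit hT hac hG hw0 hwt hmt hcov (hdis hij) (hy i)
  filter_upwards [h] with U hU hk x
  by_contra hinf
  obtain ⟨col, hcol⟩ := hk.exists_coloring
  -- Pigeonhole: `k + 1` lifts of `x` in at most `k` components.
  obtain ⟨i, j, hij, hc⟩ := Fintype.exists_ne_map_eq_of_card_lt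
    (fun i : Fin (k + 1) => col (x, y i)) (by simp)
  obtain ⟨x', hx'⟩ := exists_isExit (hy i)
    (fun h => Set.disjoint_left.1 (hdis hij) h (hy j)) (hcol _ _ hc)
  exact hU i j hij x x' ⟨hinf, hx'⟩

/-- Two vertices near `v` are connected at height `y`, but not within the slab around `y`. -/
def BadAt (X : SimpleGraph V) (r : ℕ) (S : SimpleGraph (V × W)) (B : Set W) (y : W) (v : V) :
    Prop :=
  ∃ z ∈ X.closedBall v r, ∃ z' ∈ X.closedBall v r, S.Reachable (z, y) (z', y) ∧ ¬ S.SlabRel B y z z'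

-- The sum counts the cells that meet `A`: a finite cell contributes 1 in total, an infinite one 0
-- because `∞⁻¹ = 0`.
omit [Countable V] [Countable W] in
open Classical in
lemma tsum_near_le {ι : Type*} {B : ι → Set W} {y : ι → W} {S : SimpleGraph (V × W)} {A : Set V}
    {Z : Finset V} (hZ : ∀ z ∈ A, ∃ z' ∈ Z, S.CellRel B y z z') :
    ∑' x, (if ∃ z ∈ A, S.CellRel B y x z then
      ({z | S.CellRel B y x z}.encard : ℝ≥0∞)⁻¹ else 0) ≤ Z.card := by
  calc ∑' x, (if ∃ z ∈ A, S.CellRel B y x z then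
      ({z | S.CellRel B y x z}.encard : ℝ≥0∞)⁻¹ else 0)
      ≤ ∑' x, ∑ z ∈ Z, (if x ∈ {x | S.CellRel B y z x} then
          ({x | S.CellRel B y z x}.encard : ℝ≥0∞)⁻¹ else 0) := by
        refine ENNReal.tsum_le_tsum fun x => ?_
        split_ifs with h
        · obtain ⟨z, hz, hxz⟩ := h
          obtain ⟨z', hz', hzz'⟩ := hZ z hz
          have hxz' := hxz.trans hzz'
          refine le_trans ?_ (Finset.single_le_sum (fun _ _ => zero_le) hz')
          rw [if_pos (show x ∈ {x | S.CellRel B y z' x} from hxz'.symm), hxz'.setOf_eq]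
        · exact zero_le
    _ = ∑ z ∈ Z, ∑' x, (if x ∈ {x | S.CellRel B y z x} then
          ({x | S.CellRel B y z x}.encard : ℝ≥0∞)⁻¹ else 0) :=
        Summable.tsum_finsetSum fun _ _ => ENNReal.summable
    _ ≤ ∑ z ∈ Z, 1 := Finset.sum_le_sum fun z _ => by
        rw [tsum_ite_mem]; exact ENNReal.mul_inv_le_one _
    _ = Z.card := by simp

-- Away from the bad events, vertices of the ball whose lifts have the same component labels at all
-- `k + 1` heights share a cell; one vertex per label vector suffices.
omit [Countable V] [Countable W] in
lemma exists_finset_cellRel {k : ℕ} {B : Fin (k + 1) → Set W} {y : Fin (k + 1) → W}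
    {S : SimpleGraph (V × W)} (hS : S.HasAtMostComponents k) {r : ℕ} {v : V}
    (hbad : ∀ i, ¬ BadAt X r S (B i) (y i) v) :
    ∃ Z : Finset V, Z.card ≤ k ^ (k + 1) ∧
      ∀ z ∈ X.closedBall v r, ∃ z' ∈ Z, S.CellRel B y z z' := by
  classical
  obtain ⟨col, hcol⟩ := hS.exists_coloring
  let c : V → Fin (k + 1) → Fin k := fun z i => col (z, y i)
  refine ⟨Finset.univ.image fun a => if h : ∃ z ∈ X.closedBall v r, c z = a then h.choose else v,
    Finset.card_image_le.trans (by simp), fun z hz => ?_⟩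
  have h : ∃ z' ∈ X.closedBall v r, c z' = c z := ⟨z, hz, rfl⟩
  refine ⟨h.choose, Finset.mem_image.2 ⟨c z, Finset.mem_univ _, dif_pos h⟩, fun i => ?_⟩
  by_contra hn
  exact hbad i ⟨z, hz, h.choose, h.choose_spec.1,
    hcol _ _ (congrFun h.choose_spec.2 i).symm, hn⟩

omit [Countable V] [Countable W] in
lemma le_encard_near_mul_inv {r n : ℕ} (hfin : ∀ v, (X.neighborSet v).Finite)
    (hgrow : ∀ K : Set V, K.Finite → n * K.ncard ≤ (⋃ z ∈ K, X.closedBall z r).ncard)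
    {K : Set V} (hK : K.Finite) (hne : K.Nonempty) :
    (n : ℝ≥0∞) ≤ (⋃ z ∈ K, X.closedBall z r).encard * (K.encard : ℝ≥0∞)⁻¹ := by
  have hN : (⋃ z ∈ K, X.closedBall z r).Finite := hK.biUnion fun z _ => finite_closedBall hfin z r
  rw [← hN.cast_ncard_eq, ← hK.cast_ncard_eq]
  have h0 : (K.ncard : ℝ≥0∞) ≠ 0 := by
    simpa using (Set.ncard_pos hK).2 hne |>.ne'
  rw [← div_eq_mul_inv, ENNReal.le_div_iff_mul_le (Or.inl (by simpa using h0)) (Or.inl (by simp))]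
  simpa using (by exact_mod_cast hgrow K hK :
    (n : ℝ≥0∞) * K.ncard ≤ ((⋃ z ∈ K, X.closedBall z r).ncard : ℝ≥0∞))

omit [Countable V] [Countable W] in
lemma setOf_cellRel_nonempty {ι : Type*} {B : ι → Set W} {y : ι → W} {S : SimpleGraph (V × W)}
    (x : V) : {z | S.CellRel B y x z}.Nonempty := ⟨x, CellRel.refl x⟩

omit [IsProbabilityMeasure ν] in
include hT in
lemma measurableSet_badAt (r : ℕ) (B : Set W) (y : W) (v : V) :
    MeasurableSet {U | BadAt X r (T U) B y v} :=
  (Measurable.exists fun z => measurable_const.and <| Measurable.exists fun z' =>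
    measurable_const.and <| (measurable_reachable hT _ _).and
      (measurable_slabRel hT B y z z').not : Measurable fun U => BadAt X r (T U) B y v).setOf

include hT hac hG hw0 hwt hmt in
/-- The mass transport inequality for cells: if all finite sets grow by a factor `n` within
distance `r`, then vertices see on average at least `n` cells within distance `r`. -/
lemma growth_le_of_cells (hfin : ∀ v, (X.neighborSet v).Finite)
    (hcov : ∀ v, ∃ i, ∃ g ∈ G, g (o i) = v) {k r n : ℕ}
    (hgrow : ∀ K : Set V, K.Finite → n * K.ncard ≤ (⋃ z ∈ K, X.closedBall z r).ncard)
    {B : Fin (k + 1) → Set W} {y : Fin (k + 1) → W}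
    (hdis : Pairwise fun i j => Disjoint (B i) (B j)) (hy : ∀ i, y i ∈ B i) :
    ∑ i, w i * (n * ν {U | (T U).HasAtMostComponents k}) ≤
      ∑ i, w i * ((k ^ (k + 1) : ℕ) * ν {U | (T U).HasAtMostComponents k} +
        (X.closedBall (o i) r).ncard *
          ∑ j, ν {U | BadAt X r (T U) (B j) (y j) (o i)}) := by
  classical
  set E : Set Λ := {U | (T U).HasAtMostComponents k}
  have hE : MeasurableSet E := (measurable_hasAtMostComponents hT k).setOf
  let near : SimpleGraph (V × W) → V → V → Prop := fun S v x =>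
    ∃ z ∈ X.closedBall v r, S.CellRel B y x z
  -- On the event `E`, `v` sends each cell within distance `r` total mass 1, spread evenly over the
  -- cell. Then `x`, in a cell `C`, receives the size of the `r`-neighbourhood of `C` divided by
  -- that of `C`.
  let f : SimpleGraph (V × W) → V → V → ℝ≥0∞ := fun S v x =>
    if S.HasAtMostComponents k then
      if near S v x then ({z | S.CellRel B y x z}.encard : ℝ≥0∞)⁻¹ else 0 else 0
  have hnear (v x : V) : Measurable fun U => near (T U) v x :=
    Measurable.exists fun z => measurable_const.and (measurable_cellRel hT B y x z)
  have hf (v x : V) : Measurable fun U => f (T U) v x :=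
    Measurable.ite hE (Measurable.ite (hnear v x).setOf
      (measurable_encard fun z => measurable_cellRel hT B y x z).inv measurable_const)
      measurable_const
  have hfG : ∀ g ∈ G, ∀ S v x,
      f (S.comap (g.toEquiv.prodCongr (Equiv.refl W))) v x = f S (g v) (g x) := by
    intro g _ S v x
    refine if_congr (hasAtMostComponents_comap _) (if_congr ?_ ?_ rfl) rfl
    · refine Iff.trans ?_ g.surjective.exists.symm
      refine exists_congr fun z => and_congr (map_mem_closedBall g).symm ?_
      exact cellRel_comap g.toEquiv
    · rw [setOf_cellRel_comap, Set.encard_preimage_of_bijective g.toEquiv.bijective]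
      rfl
  have htr := massTransport_random hmt hG f hf hfG
  have hin (i : I) : (n : ℝ≥0∞) * ν E ≤ ∫⁻ U, ∑' v, f (T U) v (o i) ∂ν := by
    rw [← lintegral_indicator_const hE]
    refine lintegral_mono_ae ?_
    filter_upwards [ae_finite_cells hT hac hG hw0 hwt hmt hcov hdis hy] with U hU
    by_cases hk : U ∈ E
    · rw [Set.indicator_of_mem hk]
      have hset (v : V) : f (T U) v (o i) =
          if v ∈ ⋃ z ∈ {z | (T U).CellRel B y (o i) z}, X.closedBall z r then
            ({z | (T U).CellRel B y (o i) z}.encard : ℝ≥0∞)⁻¹ else 0 := by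
        refine (if_pos hk).trans (if_congr ?_ rfl rfl)
        rw [Set.mem_iUnion₂]
        exact ⟨fun ⟨z, h₁, h₂⟩ => ⟨z, h₂, mem_closedBall_comm.1 h₁⟩,
          fun ⟨z, h₁, h₂⟩ => ⟨z, mem_closedBall_comm.1 h₂, h₁⟩⟩
      simp only [hset]
      rw [tsum_ite_mem]
      exact le_encard_near_mul_inv hfin hgrow (hU hk (o i)) (setOf_cellRel_nonempty _)
    · rw [Set.indicator_of_notMem hk]
      exact zero_le
  have hout (i : I) : ∫⁻ U, ∑' x, f (T U) (o i) x ∂ν ≤ (k ^ (k + 1) : ℕ) * ν E +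
      (X.closedBall (o i) r).ncard * ∑ j, ν {U | BadAt X r (T U) (B j) (y j) (o i)} := by
    have hbad (j) := measurableSet_badAt (X := X) hT r (B j) (y j) (o i)
    have hball := finite_closedBall hfin (o i) r
    rw [← lintegral_indicator_const hE, Finset.mul_sum]
    simp only [← lintegral_indicator_const (hbad _)]
    rw [← lintegral_finsetSum _ fun j _ => measurable_const.indicator (hbad j),
      ← lintegral_add_left (measurable_const.indicator hE)]
    refine lintegral_mono fun U => ?_
    by_cases hk : U ∈ E
    · have hfx (x : V) : f (T U) (o i) x = if ∃ z ∈ X.closedBall (o i) r, (T U).CellRel B y x z then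
          ({z | (T U).CellRel B y x z}.encard : ℝ≥0∞)⁻¹ else 0 := if_pos hk
      simp only [hfx]
      by_cases hb : ∀ j, ¬ BadAt X r (T U) (B j) (y j) (o i)
      · obtain ⟨Z, hZc, hZ⟩ := exists_finset_cellRel hk hb
        refine (tsum_near_le hZ).trans (le_add_right ?_)
        rw [Set.indicator_of_mem hk]
        exact_mod_cast hZc
      · push Not at hb
        obtain ⟨j, hj⟩ := hb
        -- On a bad event the crude bound is one cell per vertex of the ball.
        refine (tsum_near_le (Z := hball.toFinset)
          fun z hz => ⟨z, hball.mem_toFinset.2 hz, CellRel.refl z⟩).trans (le_add_left ?_)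
        refine le_trans ?_ (Finset.single_le_sum (fun _ _ => zero_le) (Finset.mem_univ j))
        rw [Set.indicator_of_mem (by exact hj), Set.ncard_eq_toFinset_card _ hball]
    · have hfx (x : V) : f (T U) (o i) x = 0 := if_neg hk
      simp [hfx]
  calc ∑ i, w i * (n * ν E) ≤ ∑ i, w i * ∫⁻ U, ∑' v, f (T U) v (o i) ∂ν := by
        gcongr with i; exact hin i
    _ = ∑ i, w i * ∫⁻ U, ∑' x, f (T U) (o i) x ∂ν := htr.symm
    _ ≤ _ := by gcongr with i; exact hout i

omit [Countable V] [Countable W] in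
lemma exists_pairwise_disjoint_closedBall {Y : SimpleGraph W}
    (hY : ∀ y, (Y.neighborSet y).Finite) {O : Set W} (hO : O.Infinite) (R : ℕ) :
    ∃ y : ℕ → W, (∀ i, y i ∈ O) ∧
      Pairwise fun i j => Disjoint (Y.closedBall (y i) R) (Y.closedBall (y j) R) := by
  have : Std.Symm fun a b => Disjoint (Y.closedBall a R) (Y.closedBall b R) := ⟨fun a b h => h.symm⟩
  refine exists_seq_of_forall_finset_exists' (· ∈ O)
    (fun a b => Disjoint (Y.closedBall a R) (Y.closedBall b R)) ?_
  intro s _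
  obtain ⟨b, hb, hbs⟩ := hO.exists_notMem_finite
    (s.finite_toSet.biUnion fun a _ => finite_closedBall hY a (R + R))
  refine ⟨b, hb, fun a ha => Set.disjoint_left.2 fun z hza hzb => hbs ?_⟩
  exact Set.mem_iUnion₂.2 ⟨a, ha, mem_closedBall_add hza (mem_closedBall_comm.1 hzb)⟩

-- The bad events decrease with `R`. Their intersection is empty: any one connection stays in a
-- bounded slab, and the ball around `v` has finitely many pairs.
include hT in
lemma tendsto_measure_badAt {Y : SimpleGraph W} (hfin : ∀ v, (X.neighborSet v).Finite)
    (hle : ∀ U, T U ≤ X □ Y) (r : ℕ) (y : W) (v : V) :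
    Filter.Tendsto (fun R => ν {U | BadAt X r (T U) (Y.closedBall y R) y v}) Filter.atTop
      (nhds 0) := by
  have hmono {S : SimpleGraph (V × W)} {R R' : ℕ} (h : R ≤ R') {z z' : V}
      (hz : S.SlabRel (Y.closedBall y R) y z z') : S.SlabRel (Y.closedBall y R') y z z' :=
    hz.mono (S.within_mono fun p hp => Y.closedBall_mono y h hp)
  have hanti : Antitone fun R => {U | BadAt X r (T U) (Y.closedBall y R) y v} := by
    rintro R R' h U ⟨z, hz, z', hz', h₁, h₂⟩
    exact ⟨z, hz, z', hz', h₁, fun h₃ => h₂ (hmono h h₃)⟩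
  have hempty : ⋂ R, {U | BadAt X r (T U) (Y.closedBall y R) y v} = ∅ := by
    refine Set.eq_empty_of_forall_notMem fun U hU => ?_
    have hb := finite_closedBall hfin v r
    have hR (q : V × V) : ∃ R, (T U).Reachable (q.1, y) (q.2, y) →
        (T U).SlabRel (Y.closedBall y R) y q.1 q.2 := by
      by_cases h : (T U).Reachable (q.1, y) (q.2, y)
      · obtain ⟨R, hR⟩ := exists_reachable_within (hle U) h
        exact ⟨R, fun _ => hR⟩
      · exact ⟨0, fun h' => absurd h' h⟩
    choose ρ hρ using hR
    obtain ⟨M, hM⟩ := ((hb.prod hb).image ρ).bddAbove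
    obtain ⟨z, hz, z', hz', h₁, h₂⟩ := Set.mem_iInter.1 hU M
    exact h₂ (hmono (hM ⟨(z, z'), ⟨hz, hz'⟩, rfl⟩) (hρ (z, z') h₁))
  have := tendsto_measure_iInter_atTop (μ := ν)
    (fun R => (measurableSet_badAt (X := X) hT r (Y.closedBall y R) y v).nullMeasurableSet)
    hanti ⟨0, measure_ne_top _ _⟩
  rwa [hempty, measure_empty] at this

include hT in
omit [IsProbabilityMeasure ν] in
lemma measure_badAt_apply {Y : SimpleGraph W} (h : Y ≃g Y)
    (hH : IsInvariantUnder ν T ((Equiv.refl V).prodCongr h.toEquiv)) (r R : ℕ) (y : W) (v : V) :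
    ν {U | BadAt X r (T U) (Y.closedBall (h y) R) (h y) v} =
      ν {U | BadAt X r (T U) (Y.closedBall y R) y v} := by
  obtain ⟨θ, hθ, hTθ⟩ := hH
  rw [← hθ.measure_preimage (measurableSet_badAt (X := X) hT r _ y v).nullMeasurableSet]
  congr 1
  ext U
  have hball : Y.closedBall y R = h.toEquiv ⁻¹' Y.closedBall (h y) R :=
    Set.ext fun z => (map_mem_closedBall h).symm
  refine exists_congr fun z => and_congr Iff.rfl <| exists_congr fun z' => and_congr Iff.rfl ?_
  rw [hTθ, reachable_comap_equiv, hball, slabRel_comap_right]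
  rfl

omit [Countable V] in
lemma exists_growth (hfin : ∀ v, (X.neighborSet v).Finite) (hna : X.IsNonamenable) (n : ℕ) :
    ∃ r, ∀ K : Set V, K.Finite → n * K.ncard ≤ (⋃ z ∈ K, X.closedBall z r).ncard := by
  obtain ⟨c, hc, h⟩ := hna
  obtain ⟨r, hr⟩ := pow_unbounded_of_one_lt (n : ℝ) (show 1 < 1 + c by linarith)
  refine ⟨r, fun K hK => ?_⟩
  have := pow_mul_ncard_le hfin hc.le h hK r
  have h2 : (n : ℝ) * K.ncard ≤ (1 + c) ^ r * K.ncard := by gcongr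
  exact_mod_cast h2.trans this

/-- On the product of a nonamenable graph with a unimodular quasi-transitive group of automorphisms
and a graph whose automorphism group has an infinite orbit, every invariant random forest has
infinitely many components. -/
theorem ae_infinite_connectedComponent {Y : SimpleGraph W} (hXconn : X.Connected)
    (hfin : ∀ v, (X.neighborSet v).Finite) (hna : X.IsNonamenable) (hqt : IsQuasiTransitive G)
    (huni : IsUnimodularGroup G) (hY : ∀ y, (Y.neighborSet y).Finite) {H : Subgroup (Y ≃g Y)}
    (hHorb : ∃ y : W, (MulAction.orbit H y).Infinite) (hle : ∀ U, T U ≤ X □ Y)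
    (hT : ∀ u v, Measurable fun U => (T U).Adj u v) (hac : ∀ᵐ U ∂ν, (T U).IsAcyclic)
    (hG : ∀ g ∈ G, IsInvariantUnder ν T (g.toEquiv.prodCongr (Equiv.refl W)))
    (hH : ∀ h ∈ H, IsInvariantUnder ν T ((Equiv.refl V).prodCongr h.toEquiv)) :
    ∀ᵐ U ∂ν, Infinite (T U).ConnectedComponent := by
  obtain ⟨I, _, _, o, w, hw0, hwt, hcov, hmt⟩ := exists_massTransport hXconn hfin hqt huni
  have hk (k : ℕ) : ν {U | (T U).HasAtMostComponents k} = 0 := by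
    by_contra he
    set e := ν {U | (T U).HasAtMostComponents k}
    -- One extra unit absorbs the bad events, the other makes the final inequality strict.
    obtain ⟨r, hgrow⟩ := exists_growth hfin hna (k ^ (k + 1) + 1 + 1)
    obtain ⟨y₀, hy₀⟩ := hHorb
    -- The heights depend on `R`, so `R` is chosen by an estimate at the fixed height `y₀`, which
    -- `H`-invariance transfers to the whole orbit.
    have hR : ∀ᶠ R in Filter.atTop, ∀ i, ((X.closedBall (o i) r).ncard : ℝ≥0∞) *
        ((k + 1 : ℕ) * ν {U | BadAt X r (T U) (Y.closedBall y₀ R) y₀ (o i)}) ≤ e := by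
      refine Filter.eventually_all.2 fun i => ?_
      have h := ENNReal.Tendsto.const_mul (a := ((X.closedBall (o i) r).ncard : ℝ≥0∞))
        (ENNReal.Tendsto.const_mul (a := ((k + 1 : ℕ) : ℝ≥0∞))
          (tendsto_measure_badAt (ν := ν) hT hfin hle r y₀ (o i))
          (Or.inr (ENNReal.natCast_ne_top _))) (Or.inr (ENNReal.natCast_ne_top _))
      rw [mul_zero, mul_zero] at h
      exact h.eventually_le_const (pos_iff_ne_zero.2 he)
    obtain ⟨R, hR⟩ := hR.exists
    obtain ⟨y, hyO, hdis⟩ := exists_pairwise_disjoint_closedBall hY hy₀ R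
    have hbad (i : I) (j : Fin (k + 1)) :
        ν {U | BadAt X r (T U) (Y.closedBall (y j) R) (y j) (o i)} =
          ν {U | BadAt X r (T U) (Y.closedBall y₀ R) y₀ (o i)} := by
      obtain ⟨h, hh⟩ := hyO j
      rw [← hh]
      exact measure_badAt_apply hT h.1 (hH h.1 h.2) r R y₀ (o i)
    have key := growth_le_of_cells hT hac hG hw0 hwt hmt hfin hcov hgrow
      (B := fun j : Fin (k + 1) => Y.closedBall (y j) R) (y := fun j => y j)
      (fun i j hij => hdis fun h => hij (Fin.ext h)) (fun j => Y.mem_closedBall_self _ _)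
    have key' : (∑ i, w i) * (((k ^ (k + 1) + 1 + 1 : ℕ) : ℝ≥0∞) * e) ≤
        (∑ i, w i) * (((k ^ (k + 1) + 1 : ℕ) : ℝ≥0∞) * e) := by
      rw [Finset.sum_mul, Finset.sum_mul]
      refine key.trans (Finset.sum_le_sum fun i _ => ?_)
      refine mul_le_mul_right ?_ _
      simp only [hbad, Finset.sum_const, Finset.card_univ, Fintype.card_fin, nsmul_eq_mul]
      rw [Nat.cast_add_one (k ^ (k + 1)), add_mul, one_mul]
      exact add_le_add_right (hR i) _
    have hw : (∑ i, w i) ≠ 0 := fun h =>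
      hw0 (Classical.arbitrary I) (Finset.sum_eq_zero_iff.1 h _ (Finset.mem_univ _))
    have hw' : (∑ i, w i) ≠ ∞ := ENNReal.sum_ne_top.2 fun i _ => hwt i
    have he' : e ≠ ∞ := measure_ne_top _ _
    refine absurd key' (not_le.2 ?_)
    rw [Nat.cast_add_one (k ^ (k + 1) + 1), add_mul, one_mul, mul_add]
    exact ENNReal.lt_add_right
      (ENNReal.mul_ne_top hw' (ENNReal.mul_ne_top (ENNReal.natCast_ne_top _) he'))
      (mul_ne_zero hw he)
  have h0 : ∀ᵐ U ∂ν, ∀ k, ¬ (T U).HasAtMostComponents k :=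
    ae_all_iff.2 fun k => measure_eq_zero_iff_ae_notMem.1 (hk k)
  filter_upwards [h0] with U hU
  by_contra h
  obtain ⟨k, hk⟩ := exists_hasAtMostComponents h
  exact hU k hk

end RandomForest

end SimpleGraph

/-! ### Application to the free minimal spanning forest on the product -/

namespace SimpleGraph

variable {V W : Type*}

/-- Automorphisms of the factors act on the product. -/
def boxProdAut {X : SimpleGraph V} {Y : SimpleGraph W} (g : X ≃g X) (h : Y ≃g Y) :
    (X □ Y) ≃g (X □ Y) where
  toEquiv := g.toEquiv.prodCongr h.toEquiv
  map_rel_iff' := by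
    rintro ⟨x, y⟩ ⟨x', y'⟩
    have h₁ : g x = g x' ↔ x = x' := g.injective.eq_iff
    have h₂ : h y = h y' ↔ y = y' := h.injective.eq_iff
    have h₃ : X.Adj (g x) (g x') ↔ X.Adj x x' := g.map_adj_iff
    have h₄ : Y.Adj (h y) (h y') ↔ Y.Adj y y' := h.map_adj_iff
    rw [boxProd_adj, boxProd_adj]
    exact or_congr (and_congr h₃ h₂) (and_congr h₄ h₁)

end SimpleGraph

open SimpleGraph

theorem corollary2p1 {V W Ω : Type*}
    (X : SimpleGraph V) (Y : SimpleGraph W)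
    (hXconn : X.Connected)
    (hXfin : ∀ v : V, (X.neighborSet v).Finite)
    (hXna : X.IsNonamenable)
    (G : Subgroup (X ≃g X))
    (hGclosed : IsClosed (G : Set (X ≃g X)))
    (hGqt : SimpleGraph.IsQuasiTransitive G)
    (hGuni : IsUnimodularGroup G)
    (hYfin : ∀ w : W, (Y.neighborSet w).Finite)
    (H : Subgroup (Y ≃g Y))
    (hH : ∃ w : W, (MulAction.orbit H w).Infinite)
    [MeasurableSpace Ω] (P : MeasureTheory.Measure Ω) [MeasureTheory.IsProbabilityMeasure P]
    (U : (X □ Y).edgeSet → Ω → ℝ)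
    (hUmeas : ∀ e, Measurable (U e))
    (hUunif : ∀ e, MeasureTheory.pdf.IsUniform (U e) (Set.Icc (0 : ℝ) 1) P MeasureTheory.volume)
    (hUindep : ProbabilityTheory.iIndepFun U P) :
    ∀ᵐ ω ∂P, Infinite
      ((X □ Y).freeMinimalSpanningForest (fun e => U e ω)).ConnectedComponent := by
  have := hXconn.nonempty
  by_cases hYinf : Infinite Y.ConnectedComponent
  · exact Filter.Eventually.of_forall fun ω =>
      infinite_connectedComponent_of_boxProd (freeMinimalSpanningForest_le _)
  rw [not_infinite_iff_finite] at hYinf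
  have : Countable W := countable_of_finite_connectedComponent hYfin
  have := hXconn.preconnected.subsingleton_connectedComponent
  have : Countable V := countable_of_finite_connectedComponent hXfin
  set μ : Measure ℝ := ProbabilityTheory.cond volume (Set.Icc (0 : ℝ) 1)
  have : IsProbabilityMeasure μ :=
    ProbabilityTheory.cond_isProbabilityMeasure_of_finite (by simp) (by simp)
  have : NullSingletonClass μ := ⟨fun x => by simp [μ, ProbabilityTheory.cond]⟩
  set ν : Measure ((X □ Y).edgeSet → ℝ) := Measure.infinitePi fun _ => μ
  -- Passing to the product space of labels lets automorphisms act by permuting coordinates.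
  have hlaw : MeasurePreserving (fun ω e => U e ω) P ν := by
    refine ⟨measurable_pi_iff.2 hUmeas, ?_⟩
    rw [(ProbabilityTheory.iIndepFun_iff_map_fun_eq_infinitePi_map hUmeas).1 hUindep]
    exact congrArg Measure.infinitePi (funext hUunif)
  have hinv (φ : (X □ Y) ≃g (X □ Y)) :
      IsInvariantUnder ν (X □ Y).freeMinimalSpanningForest φ.toEquiv :=
    ⟨_, measurePreserving_relabel μ φ.mapEdgeSet, freeMinimalSpanningForest_relabel φ⟩
  refine hlaw.quasiMeasurePreserving.ae (ae_infinite_connectedComponent (ν := ν)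
    (T := (X □ Y).freeMinimalSpanningForest) hXconn hXfin hXna hGqt hGuni hYfin hH
    freeMinimalSpanningForest_le measurable_freeMinimalSpanningForest_adj ?_
    (fun g _ => hinv (boxProdAut g (RelIso.refl _))) (fun h _ => hinv (boxProdAut (RelIso.refl _) h)))
  filter_upwards [ae_injective_infinitePi μ] with U hU
  exact isAcyclic_freeMinimalSpanningForest hU
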